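/- **Theorem 1.3.** All rings are commutative with $1$. Let $\Gamma$ be a (multiplicatively written) abelian group, and let $A$ be an order, i.e. a ring whose additive group is isomorphic to $\mathbb{Z}^n$ for some $n\in\mathbb{Z}_{\ge 0}$. Let $(B_\gamma)_{\gamma\in\Gamma}$ be a $\Gamma$-grading of $A$, i.e. a system of additive subgroups $B_\gamma\subset A$ such that $B_\gamma B_{\gamma'}\subset B_{\gamma\gamma'}$ for all $\gamma,\gamma'\in\Gamma$ and such that the map $\bigoplus_{\gamma\in\Gamma}B_\gamma\to A$, $(x_\gamma)_\gamma\mapsto\sum_\gamma x_\gamma$, is bijective; then $B_1$ is a subring of $A$ containing $1$. For a ring $R$ write $\mathrm{Id}(R)=\{e\in R: e^2=e\}$, and call $R$ connected if $\#\mathrm{Id}(R)=2$. Then: (i) the nilradical $\sqrt{0_A}$ is a homogeneous ideal of $A$, i.e. for each $(x_\gamma)_\gamma\in\bigoplus_{\gamma\in\Gamma}B_\gamma$ the element $\sum_\gamma x_\gamma$ is nilpotent if and only if every $x_\gamma$ is nilpotent; (ii) $\mathrm{Id}(A)=\mathrm{Id}(B_1)$, and $A$ is connected if and only if $B_1$ is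 connected; (iii) if $B_1$ is connected, then every root of unity of $A$, i.e. every $x\in A$ with $x^n=1$ for some $n\in\mathbb{Z}_{>0}$, is homogeneous, i.e. lies in $B_\gamma$ for some $\gamma\in\Gamma$. -/

import Mathlib

namespace GradedOrder

/-- An order: a commutative ring whose additive group is isomorphic to `ℤⁿ` for some `n ≥ 0`. -/
def IsOrder (A : Type*) [CommRing A] : Prop :=
  ∃ n : ℕ, Nonempty (A ≃+ (Fin n → ℤ))

/-- A grading of the ring `A` by the multiplicatively written abelian group `Γ`.
`DirectSum.IsInternal B` says that the sum map `⨁ γ, B γ → A` is bijective. -/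
structure IsGrading {Γ A : Type*} [CommGroup Γ] [DecidableEq Γ] [CommRing A]
    (B : Γ → AddSubgroup A) : Prop where
  mul_mem : ∀ (γ γ' : Γ) (x y : A), x ∈ B γ → y ∈ B γ' → x * y ∈ B (γ * γ')
  isInternal : DirectSum.IsInternal B

theorem IsGrading.one_mem {Γ A : Type*} [CommGroup Γ] [DecidableEq Γ] [CommRing A]
    {B : Γ → AddSubgroup A} (hB : IsGrading B) : (1 : A) ∈ B 1 := by
  classical
  obtain ⟨d, hd⟩ := hB.isInternal.2 1
  have hd' : ∑ γ ∈ DFinsupp.support d, (d γ : A) = 1 := by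
    rw [← hd, DirectSum.coeAddMonoidHom_eq_dfinsuppSum, DFinsupp.sum]
  have key : ∀ (δ : Γ) (a : A), a ∈ B δ → (d 1 : A) * a = a := by
    intro δ a ha
    let y : DirectSum Γ (fun γ => B γ) := ∑ γ ∈ DFinsupp.support d,
      DirectSum.of (fun γ => B γ) (γ * δ) ⟨(d γ : A) * a, hB.mul_mem _ _ _ _ (d γ).2 ha⟩
    have hy : y = DirectSum.of (fun γ => B γ) δ ⟨a, ha⟩ := by
      apply hB.isInternal.1
      simp only [y, map_sum, DirectSum.coeAddMonoidHom_of]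
      rw [← Finset.sum_mul, hd', one_mul]
    have h2 : ((y δ : B δ) : A) = a := by
      rw [hy, DirectSum.of_eq_same]
    refine Eq.trans ?_ h2
    simp only [y]
    rw [DFinsupp.finsetSum_apply, AddSubgroup.val_finsetSum]
    simp only [DirectSum.coe_of_apply]
    symm
    rw [Finset.sum_eq_single (1 : Γ)]
    · simp
    · intro γ _ hγ
      simp [hγ]
    · intro h
      have : d 1 = 0 := by simpa using h
      simp [this]
  have h1 : (d 1 : A) = 1 := by
    calc (d 1 : A) = (d 1 : A) * ∑ γ ∈ DFinsupp.support d, (d γ : A) := by rw [hd', mul_one]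
      _ = ∑ γ ∈ DFinsupp.support d, (d γ : A) := by
        rw [Finset.mul_sum]
        exact Finset.sum_congr rfl fun γ _ => key γ _ (d γ).2
      _ = 1 := hd'
  rw [← h1]
  exact (d 1).2

/-- The degree-one piece `B 1` of a grading, as a subring of `A`. -/
def IsGrading.oneSubring {Γ A : Type*} [CommGroup Γ] [DecidableEq Γ] [CommRing A]
    {B : Γ → AddSubgroup A} (hB : IsGrading B) : Subring A :=
  { B 1 with
    one_mem' := hB.one_mem
    mul_mem' := fun {x y} hx hy => by
      have h := hB.mul_mem 1 1 x y hx hy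
      rwa [mul_one] at h }

/-- An additive subgroup `H` is homogeneous if a sum `∑ x_γ` with `x_γ ∈ B γ` lies in `H`
if and only if every `x_γ` does. -/
def IsHomogeneousSubgroup {Γ A : Type*} [CommGroup Γ] [DecidableEq Γ] [CommRing A]
    (B : Γ → AddSubgroup A) (H : AddSubgroup A) : Prop :=
  ∀ x : DirectSum Γ (fun γ => B γ),
    DirectSum.coeAddMonoidHom B x ∈ H ↔ ∀ γ : Γ, (x γ : A) ∈ H

/-- A homogeneous element: one that lies in some `B γ`. -/
def IsHomogeneousElement {Γ A : Type*} [CommRing A] (B : Γ → AddSubgroup A) (x : A) : Prop :=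
  ∃ γ : Γ, x ∈ B γ

/-- The set of idempotents. -/
def idempotents (R : Type*) [CommRing R] : Set R :=
  {e | e ^ 2 = e}

/-- A ring is connected if it has exactly two idempotents. -/
def IsConnectedRing (R : Type*) [CommRing R] : Prop :=
  (idempotents R).encard = 2

/-- The set of roots of unity. -/
def rootsOfOne (R : Type*) [CommRing R] : Set R :=
  {x | ∃ n : ℕ, 0 < n ∧ x ^ n = 1}

end GradedOrder

/-! An order is finite and torsion-free over `ℤ`, so its homomorphisms `σ` to `ℂ` detect nilpotents.
Unitary characters of the grading group twist each `σ` to further homomorphisms, and independence of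
characters turns a statement about all `σ x` into one about all `σ (x_i)`. Part (i) follows at once.

An idempotent has real values, and the inverse of a root of unity has conjugate values; twisting
gives `σ (y_{-i}) = conj (σ (x_i))` with `y = e` or `y = x⁻¹`. Degree zero of `e * e = e` and of `x
* x⁻¹ = 1` then says that `∑ |σ (x_i)|²` is `σ (e_0)` or `1`. By Kronecker's theorem the algebraic
integers involved, lying in `[0, 1]` under every `σ`, are `0` or `1`, so all components but one are
nilpotent.

These nilpotent components generate an ideal `J`. Expanding the equation around the remaining
component shows that a nonzero multiple of each generator lies in `J²`, so `J = 0` by nilpotence and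
torsion-freeness. -/

namespace GradedOrder

/-! ### Nilpotents, integrality and idempotents in orders -/

section Order

variable {A : Type*} [CommRing A]

theorem IsOrder.module_finite (hA : IsOrder A) : Module.Finite ℤ A := by
  obtain ⟨n, ⟨e⟩⟩ := hA
  exact Module.Finite.equiv e.toIntLinearEquiv.symm

theorem IsOrder.isAddTorsionFree (hA : IsOrder A) : IsAddTorsionFree A := by
  obtain ⟨n, ⟨e⟩⟩ := hA
  exact Function.Injective.isAddTorsionFree e.toAddMonoidHom e.injective

/-- In a ring that is finite and torsion-free over `ℤ`, an element killed by all ring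
homomorphisms to `ℂ` is nilpotent. -/
theorem isNilpotent_of_forall_ringHom_eq_zero [Module.Finite ℤ A] [IsAddTorsionFree A] {x : A}
    (h : ∀ σ : A →+* ℂ, σ x = 0) : IsNilpotent x := by
  by_contra hx
  -- A prime avoiding `S` omits `x` and all nonzero integers, so its quotient is a domain of
  -- characteristic zero.
  let S : Submonoid A := (nonZeroDivisors ℤ).map (Int.castRingHom A) ⊔ Submonoid.powers x
  have hS : Disjoint ((⊥ : Ideal A) : Set A) S := by
    rw [Set.disjoint_left]
    intro a ha haS
    obtain rfl : a = 0 := by simpa using ha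
    obtain ⟨_, ⟨m, hm, rfl⟩, _, ⟨k, rfl⟩, hz⟩ := Submonoid.mem_sup.mp haS
    apply hx
    refine ⟨k, ?_⟩
    have hz' : m • x ^ k = 0 := by simpa using hz
    exact (smul_eq_zero.mp hz').resolve_left (nonZeroDivisors.ne_zero hm)
  obtain ⟨P, hP, -, hdisj⟩ := Ideal.exists_le_prime_disjoint _ S hS
  have hinj : Function.Injective (algebraMap ℤ (A ⧸ P)) := by
    rw [injective_iff_map_eq_zero]
    intro m hm
    by_contra hm0
    have hmem : ((m : ℤ) : A) ∈ P := by
      rw [← Ideal.Quotient.eq_zero_iff_mem]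
      simpa using hm
    exact Set.disjoint_left.mp hdisj hmem
      (Submonoid.mem_sup_left ⟨m, mem_nonZeroDivisors_of_ne_zero hm0, by simp⟩)
  have : FaithfulSMul ℤ (A ⧸ P) := (faithfulSMul_iff_algebraMap_injective _ _).mpr hinj
  have : Module.IsTorsionFree ℤ (A ⧸ P) := inferInstance
  have : Algebra.IsIntegral ℤ (A ⧸ P) := inferInstance
  let φ : (A ⧸ P) →ₐ[ℤ] ℂ := IsAlgClosed.lift
  -- A nonzero ideal of a domain integral over `ℤ` meets `ℤ` nontrivially.
  have hker : RingHom.ker φ.toRingHom = ⊥ := by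
    apply Ideal.eq_bot_of_comap_eq_bot (R := ℤ)
    rw [eq_bot_iff]
    intro m hm
    have : φ (algebraMap ℤ (A ⧸ P) m) = 0 := hm
    rw [AlgHom.commutes] at this
    simpa using this
  have hφ : φ (Ideal.Quotient.mk P x) = 0 := h (φ.toRingHom.comp (Ideal.Quotient.mk P))
  have hmem : Ideal.Quotient.mk P x ∈ RingHom.ker φ.toRingHom := hφ
  rw [hker, Ideal.mem_bot, Ideal.Quotient.eq_zero_iff_mem] at hmem
  exact Set.disjoint_left.mp hdisj hmem (Submonoid.mem_sup_right (Submonoid.mem_powers x))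

/-- If all complex values of an element lie in the unit interval, they are `0` or `1`. -/
theorem eq_zero_or_one_of_forall_mem_unitInterval [Module.Finite ℤ A] {a : A}
    (h : ∀ σ : A →+* ℂ, ∃ r : ℝ, 0 ≤ r ∧ r ≤ 1 ∧ σ a = r) (σ : A →+* ℂ) :
    σ a = 0 ∨ σ a = 1 := by
  obtain ⟨s, hs⟩ := Module.Finite.fg_top (R := ℤ) (M := A)
  have hint (x : A) : IsIntegral ℤ (σ x) :=
    (Algebra.IsIntegral.isIntegral (R := ℤ) x).map σ.toIntAlgHom
  let K : IntermediateField ℚ ℂ := IntermediateField.adjoin ℚ (σ '' (s : Set A))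
  have hfin : FiniteDimensional ℚ K := by
    have : Finite (σ '' (s : Set A)) := (s.finite_toSet.image σ).to_subtype
    apply IntermediateField.finiteDimensional_adjoin
    rintro _ ⟨x, -, rfl⟩
    exact (hint x).tower_top
  have : NumberField K := { to_charZero := inferInstance, to_finiteDimensional := hfin }
  have hmem (x : A) : σ x ∈ K := by
    have hx : x ∈ Submodule.span ℤ (s : Set A) := hs ▸ Submodule.mem_top
    induction hx using Submodule.span_induction with
    | mem x hx => exact IntermediateField.subset_adjoin _ _ ⟨x, hx, rfl⟩
    | zero => rw [map_zero]; exact K.zero_mem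
    | add x y _ _ hx hy => rw [map_add]; exact K.add_mem hx hy
    | smul m x _ hx => rw [map_zsmul]; exact K.zsmul_mem hx m
  let τ : A →+* K := σ.codRestrict K hmem
  by_cases h0 : τ a = 0
  · left
    exact congrArg Subtype.val h0
  right
  -- Kronecker's theorem: each embedding of `K` composed with `τ` is again a homomorphism from `A`,
  -- so the bound covers all conjugates.
  obtain ⟨n, hn, hpow⟩ := NumberField.Embeddings.pow_eq_one_of_norm_le_one K ℂ h0
    ((Algebra.IsIntegral.isIntegral (R := ℤ) a).map τ.toIntAlgHom) (fun φ => by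
      obtain ⟨r, hr0, hr1, hr⟩ := h (φ.comp τ)
      rw [RingHom.comp_apply] at hr
      rw [hr, Complex.norm_real, Real.norm_of_nonneg hr0]
      exact hr1)
  obtain ⟨r, hr0, hr1, hr⟩ := h σ
  have hpow' : σ a ^ n = 1 := congrArg Subtype.val hpow
  rw [hr] at hpow' ⊢
  norm_cast at hpow' ⊢
  exact (pow_eq_one_iff_of_nonneg hr0 hn.ne').mp hpow'

/-- A finitely generated nil ideal `J`, on which multiplication by `c ≠ 0` lands in `J ^ 2`,
is zero. -/
theorem span_eq_bot_of_nsmul_mem_sq [IsAddTorsionFree A] {s : Set A} (hs : s.Finite)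
    (hnil : ∀ x ∈ s, IsNilpotent x) {c : ℕ} (hc : c ≠ 0)
    (h : ∀ x ∈ s, c • x ∈ Ideal.span s * Ideal.span s) : Ideal.span s = ⊥ := by
  set J := Ideal.span s with hJ
  have hJnil : IsNilpotent J := by
    rw [Ideal.FG.isNilpotent_iff_le_nilradical (Submodule.fg_span hs)]
    exact Ideal.span_le.mpr hnil
  have hmul : ∀ x ∈ J, (c : A) * x ∈ J * J := by
    intro x hx
    induction hx using Submodule.span_induction with
    | mem x hx => simpa using h x hx
    | zero => simp
    | add x y _ _ hx hy => rw [mul_add]; exact add_mem hx hy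
    | smul a x _ hx => rw [smul_eq_mul, mul_left_comm]; exact Ideal.mul_mem_left _ _ hx
  -- Once `J ^ k = 0`, this makes `c ^ k` annihilate `J`.
  have hpow : ∀ k : ℕ, ∀ x ∈ J, (c : A) ^ k * x ∈ J ^ (k + 1) := by
    intro k
    induction k with
    | zero => simp
    | succ k ih =>
      intro x hx
      have h2 : ∀ z ∈ J * J, (c : A) ^ k * z ∈ J ^ (k + 1 + 1) := by
        intro z hz
        induction hz using Submodule.mul_induction_on' with
        | mem_mul_mem u hu v hv =>
          rw [← mul_assoc, pow_succ J]
          exact Ideal.mul_mem_mul (ih u hu) hv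
        | add u _ v _ hu hv => rw [mul_add]; exact add_mem hu hv
      rw [pow_succ (c : A), mul_assoc]
      exact h2 _ (hmul x hx)
  obtain ⟨k, hk⟩ := hJnil
  rw [eq_bot_iff]
  intro x hx
  have hz : (c : A) ^ k * x = 0 := by
    have := Ideal.pow_le_pow_right (Nat.le_succ k) (hpow k x hx)
    rwa [hk] at this
  have hz' : (c ^ k) • x = 0 := by simpa using hz
  exact (smul_eq_zero.mp hz').resolve_left (pow_ne_zero _ hc)

/-- Idempotents lift along the nilradical, and the lift can only be `0` or `1`. -/
theorem isNilpotent_or_isNilpotent_sub_one (hA : ∀ e : A, IsIdempotentElem e → e = 0 ∨ e = 1)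
    {a : A} (ha : IsNilpotent (a * a - a)) : IsNilpotent a ∨ IsNilpotent (a - 1) := by
  let f := Ideal.Quotient.mk (nilradical A)
  obtain ⟨e, he, hea⟩ := exists_isIdempotentElem_eq_of_ker_isNilpotent f
    (fun x hx => by rwa [Ideal.mk_ker] at hx) (f a) ⟨a, rfl⟩ (by
      rw [IsIdempotentElem, ← map_mul]
      exact Ideal.Quotient.eq.mpr ha)
  have hnil : IsNilpotent (a - e) := Ideal.Quotient.eq.mp hea.symm
  rcases hA e he with rfl | rfl
  · left; simpa using hnil
  · right; exact hnil

end Order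

/-! ### Separation and independence of unitary characters -/

section Characters

variable {ι : Type*} [AddCommGroup ι]

/-- The inclusion of `ℚ ⧸ ℤ` into `ℝ ⧸ ℤ`. -/
noncomputable def ratAddCircleToReal : AddCircle (1 : ℚ) →+ AddCircle (1 : ℝ) :=
  QuotientAddGroup.map _ _ (algebraMap ℚ ℝ).toAddMonoidHom (by
    rw [AddSubgroup.zmultiples_le]
    exact ⟨1, by simp⟩)

theorem ratAddCircleToReal_injective : Function.Injective ratAddCircleToReal := by
  rw [injective_iff_map_eq_zero]
  intro q hq
  induction q using QuotientAddGroup.induction_on with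
  | H q =>
    have hq' : ((q : ℝ) : AddCircle (1 : ℝ)) = 0 := hq
    obtain ⟨m, hm⟩ := (QuotientAddGroup.eq_zero_iff _).mp hq'
    refine (QuotientAddGroup.eq_zero_iff _).mpr ⟨m, ?_⟩
    have hm' : (m : ℝ) = q := by simpa using hm
    simpa using (by exact_mod_cast hm' : (m : ℚ) = q)

/-- Unitary characters separate the elements of an abelian group. -/
theorem exists_addChar_circle_apply_ne_one {i : ι} (hi : i ≠ 0) :
    ∃ χ : AddChar ι Circle, χ i ≠ 1 := by
  obtain ⟨f, hf⟩ := CharacterModule.exists_character_apply_ne_zero_of_ne_zero hi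
  let g : ι →+ AddCircle (1 : ℚ) := f
  refine ⟨⟨fun j => AddCircle.toCircle (ratAddCircleToReal (g j)), ?_, ?_⟩, ?_⟩
  · simp
  · intro a b
    rw [map_add, map_add, AddCircle.toCircle_add]
  · intro h
    have h' : AddCircle.toCircle (ratAddCircleToReal (g i)) = AddCircle.toCircle (0 : AddCircle (1 : ℝ)) := by
      rw [AddCircle.toCircle_zero]
      exact h
    have h0 := AddCircle.injective_toCircle one_ne_zero h'
    exact hf (ratAddCircleToReal_injective (h0.trans (map_zero _).symm))

/-- Dedekind independence with the roles swapped: evaluations at points of `ι` are distinct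
characters of the dual group. -/
theorem eq_zero_of_forall_addChar_sum_eq_zero {S : Finset ι} {c : ι → ℂ}
    (h : ∀ χ : AddChar ι Circle, ∑ i ∈ S, c i * (χ i : ℂ) = 0) : ∀ i ∈ S, c i = 0 := by
  let ev (i : ι) : AddChar ι Circle →* ℂ :=
    { toFun := fun χ => (χ i : ℂ)
      map_one' := by simp
      map_mul' := by simp }
  have hev : Function.Injective ev := by
    intro i j hij
    by_contra hne
    obtain ⟨χ, hχ⟩ := exists_addChar_circle_apply_ne_one (sub_ne_zero.mpr hne)
    apply hχ
    have hχ' : χ i = χ j := Circle.coe_injective (DFunLike.congr_fun hij χ)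
    rw [AddChar.map_sub_eq_div, hχ', div_self']
  have hli := (linearIndependent_monoidHom (AddChar ι Circle) ℂ).comp ev hev
  rw [linearIndependent_iff'] at hli
  apply hli S c
  ext χ
  simp only [Finset.sum_apply, Pi.smul_apply, smul_eq_mul, Pi.zero_apply]
  exact h χ

end Characters

/-! ### Twisting homomorphisms and isolating components -/

section Graded

open DirectSum

variable {ι A : Type*} [AddCommGroup ι] [DecidableEq ι] [CommRing A]
  (𝒜 : ι → AddSubgroup A) [GradedRing 𝒜]

theorem proj_mem (i : ι) (x : A) : GradedRing.proj 𝒜 i x ∈ 𝒜 i := by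
  rw [GradedRing.proj_apply]
  exact (decompose 𝒜 x i).2

theorem proj_of_mem {i : ι} {x : A} (hx : x ∈ 𝒜 i) : GradedRing.proj 𝒜 i x = x :=
  decompose_of_mem_same 𝒜 hx

theorem proj_of_mem_ne {i j : ι} {x : A} (hx : x ∈ 𝒜 i) (hij : i ≠ j) :
    GradedRing.proj 𝒜 j x = 0 :=
  decompose_of_mem_ne 𝒜 hx hij

theorem proj_add_mul {i : ι} {a : A} (ha : a ∈ 𝒜 i) (j : ι) (b : A) :
    GradedRing.proj 𝒜 (i + j) (a * b) = a * GradedRing.proj 𝒜 j b :=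
  coe_decompose_mul_add_of_left_mem 𝒜 ha

theorem exists_finset_proj (x : A) : ∃ S : Finset ι, (∀ i ∉ S, GradedRing.proj 𝒜 i x = 0) ∧
    ∀ T : Finset ι, S ⊆ T → ∑ i ∈ T, GradedRing.proj 𝒜 i x = x := by
  classical
  have h0 : ∀ i ∉ (decompose 𝒜 x).support, GradedRing.proj 𝒜 i x = 0 := by
    intro i hi
    rw [GradedRing.proj_apply, DFinsupp.notMem_support_iff.mp hi]
    rfl
  refine ⟨(decompose 𝒜 x).support, h0, fun T hT => ?_⟩
  rw [← Finset.sum_subset hT fun i _ hi => h0 i hi]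
  exact sum_support_decompose 𝒜 x

/-- The twist of a complex-valued ring homomorphism by a character of the grading group. -/
noncomputable def twist (χ : AddChar ι Circle) (σ : A →+* ℂ) : A →+* ℂ :=
  (DirectSum.toSemiring (A := fun i => 𝒜 i)
    (fun i => (AddMonoidHom.mulLeft (χ i : ℂ)).comp (σ.toAddMonoidHom.comp (𝒜 i).subtype))
    (by simp [GradedMonoid.GOne.one])
    (fun {i j} a b => by
      simp [GradedMonoid.GMul.mul, AddChar.map_add_eq_mul]
      ring)).comp (decomposeRingEquiv 𝒜).toRingHom

theorem twist_of_mem (χ : AddChar ι Circle) (σ : A →+* ℂ) {i : ι} {x : A} (hx : x ∈ 𝒜 i) :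
    twist 𝒜 χ σ x = σ x * χ i := by
  have h : (decomposeRingEquiv 𝒜).toRingHom x = DirectSum.of (fun i => 𝒜 i) i ⟨x, hx⟩ :=
    decompose_of_mem 𝒜 hx
  rw [twist, RingHom.comp_apply, h, DirectSum.toSemiring_of]
  simp [mul_comm]

theorem twist_eq_sum (χ : AddChar ι Circle) (σ : A →+* ℂ) {S : Finset ι} {x : A}
    (hS : ∑ i ∈ S, GradedRing.proj 𝒜 i x = x) :
    twist 𝒜 χ σ x = ∑ i ∈ S, σ (GradedRing.proj 𝒜 i x) * χ i := by
  conv_lhs => rw [← hS, map_sum]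
  exact Finset.sum_congr rfl fun i _ => twist_of_mem 𝒜 χ σ (proj_mem 𝒜 i x)

theorem ringHom_proj_eq_zero {x : A} (h : ∀ σ : A →+* ℂ, σ x = 0) (σ : A →+* ℂ) (i : ι) :
    σ (GradedRing.proj 𝒜 i x) = 0 := by
  obtain ⟨S, hS0, hS⟩ := exists_finset_proj 𝒜 x
  by_cases hi : i ∈ S
  · refine eq_zero_of_forall_addChar_sum_eq_zero (c := fun i => σ (GradedRing.proj 𝒜 i x))
      (fun χ => ?_) i hi
    rw [← twist_eq_sum 𝒜 χ σ (hS S subset_rfl), h]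
  · rw [hS0 i hi, map_zero]

/-- If `y` is the complex conjugate of `x` under every homomorphism to `ℂ`, then so are their
components of opposite degrees. -/
theorem ringHom_proj_neg_eq_conj {x y : A} (h : ∀ σ : A →+* ℂ, σ y = starRingEnd ℂ (σ x))
    (σ : A →+* ℂ) (i : ι) :
    σ (GradedRing.proj 𝒜 (-i) y) = starRingEnd ℂ (σ (GradedRing.proj 𝒜 i x)) := by
  obtain ⟨S, hS0, hS⟩ := exists_finset_proj 𝒜 x
  obtain ⟨T, hT0, hT⟩ := exists_finset_proj 𝒜 y
  -- Large enough that `U` contains the support of `x` and `-U` that of `y`.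
  let U : Finset ι := S ∪ T.map (Equiv.neg ι).toEmbedding
  by_cases hi : i ∈ U
  · have key := eq_zero_of_forall_addChar_sum_eq_zero (S := U) (c := fun i =>
      σ (GradedRing.proj 𝒜 i x) - starRingEnd ℂ (σ (GradedRing.proj 𝒜 (-i) y)))
      (fun χ => by
        have hx := twist_eq_sum 𝒜 χ σ (hS U Finset.subset_union_left)
        have hy := twist_eq_sum 𝒜 χ σ (hT (U.map (Equiv.neg ι).toEmbedding) (by
          intro j hj
          simp [U, hj]))
        rw [Finset.sum_map, h] at hy
        have hy' := congrArg (starRingEnd ℂ) hy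
        rw [Complex.conj_conj, map_sum, hx] at hy'
        simp only [sub_mul, Finset.sum_sub_distrib]
        rw [hy', sub_eq_zero]
        refine Finset.sum_congr rfl fun j _ => ?_
        simp only [Equiv.coe_toEmbedding, Equiv.neg_apply, AddChar.map_neg_eq_inv,
          Circle.coe_inv_eq_conj, map_mul, Complex.conj_conj]) i hi
    simp only [sub_eq_zero] at key
    rw [key, Complex.conj_conj]
  · have hiS : i ∉ S := fun hh => hi (Finset.mem_union_left _ hh)
    have hiT : -i ∉ T := fun hh => hi (Finset.mem_union_right _ (by simpa using hh))
    rw [hS0 i hiS, hT0 _ hiT]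
    simp

theorem proj_zero_mul {S : Finset ι} {x : A} (hS : ∑ i ∈ S, GradedRing.proj 𝒜 i x = x) (y : A) :
    GradedRing.proj 𝒜 0 (x * y) =
      ∑ i ∈ S, GradedRing.proj 𝒜 i x * GradedRing.proj 𝒜 (-i) y := by
  conv_lhs => rw [← hS, Finset.sum_mul, map_sum]
  refine Finset.sum_congr rfl fun i _ => ?_
  rw [← proj_add_mul 𝒜 (proj_mem 𝒜 i x), add_neg_cancel]

/-- The ideal generated by the components of `x` in degrees other than `i`. -/
def offDiagonal (x : A) (i : ι) : Ideal A :=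
  Ideal.span ((fun j => GradedRing.proj 𝒜 j x) '' {j | j ≠ i})

theorem proj_mem_offDiagonal {x : A} {i j : ι} (hj : j ≠ i) :
    GradedRing.proj 𝒜 j x ∈ offDiagonal 𝒜 x i :=
  Ideal.subset_span ⟨j, hj, rfl⟩

theorem sub_proj_mem_offDiagonal (x : A) (i : ι) :
    x - GradedRing.proj 𝒜 i x ∈ offDiagonal 𝒜 x i := by
  obtain ⟨S, -, hS⟩ := exists_finset_proj 𝒜 x
  have h := hS (insert i S) (Finset.subset_insert i S)
  rw [← Finset.add_sum_erase _ _ (Finset.mem_insert_self i S)] at h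
  rw [sub_eq_of_eq_add' h.symm]
  exact sum_mem fun j hj => proj_mem_offDiagonal 𝒜 (Finset.ne_of_mem_erase hj)

theorem proj_mem_offDiagonal_mul {x : A} {i : ι} {z : A}
    (hz : z ∈ offDiagonal 𝒜 x i * offDiagonal 𝒜 x i) (j : ι) :
    GradedRing.proj 𝒜 j z ∈ offDiagonal 𝒜 x i * offDiagonal 𝒜 x i := by
  have h : (offDiagonal 𝒜 x i).IsHomogeneous 𝒜 := by
    apply Ideal.homogeneous_span
    rintro _ ⟨k, -, rfl⟩
    exact ⟨k, proj_mem 𝒜 k x⟩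
  exact (h.mul h) j hz

/-- Reduces homogeneity to a computation modulo the square of the off-diagonal ideal, which must
then vanish. -/
theorem mem_of_forall_nsmul_proj_mem [IsAddTorsionFree A] {x : A} {i : ι}
    (hnil : ∀ j ≠ i, IsNilpotent (GradedRing.proj 𝒜 j x)) {c : ℕ} (hc : c ≠ 0)
    (h : ∀ j ≠ i, c • GradedRing.proj 𝒜 j x ∈ offDiagonal 𝒜 x i * offDiagonal 𝒜 x i) :
    x ∈ 𝒜 i := by
  have hbot : offDiagonal 𝒜 x i = ⊥ := by
    refine span_eq_bot_of_nsmul_mem_sq ?_ (by rintro _ ⟨j, hj, rfl⟩; exact hnil j hj) hc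
      (by rintro _ ⟨j, hj, rfl⟩; exact h j hj)
    obtain ⟨S, hS0, -⟩ := exists_finset_proj 𝒜 x
    refine ((S.finite_toSet.image fun j => GradedRing.proj 𝒜 j x).insert 0).subset ?_
    rintro _ ⟨j, -, rfl⟩
    by_cases hj : j ∈ S
    · exact Or.inr ⟨j, hj, rfl⟩
    · exact Or.inl (hS0 j hj)
  have hx := sub_proj_mem_offDiagonal 𝒜 x i
  rw [hbot, Ideal.mem_bot, sub_eq_zero] at hx
  rw [hx]
  exact proj_mem 𝒜 i x

/-! ### Idempotents and roots of unity in graded orders -/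

variable [Module.Finite ℤ A] [IsAddTorsionFree A]

theorem isNilpotent_proj {x : A} (hx : IsNilpotent x) (i : ι) :
    IsNilpotent (GradedRing.proj 𝒜 i x) :=
  isNilpotent_of_forall_ringHom_eq_zero fun σ =>
    ringHom_proj_eq_zero 𝒜 (fun σ => (hx.map σ).eq_zero) σ i

/-- Idempotents of a graded order have degree zero. -/
theorem mem_zero_of_isIdempotentElem {e : A} (he : IsIdempotentElem e) : e ∈ 𝒜 0 := by
  have hconj := ringHom_proj_neg_eq_conj 𝒜 (x := e) (y := e) (fun σ => by
    rcases IsIdempotentElem.iff_eq_zero_or_one.mp (he.map σ) with h | h <;> simp [h])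
  obtain ⟨S, hS0, hS⟩ := exists_finset_proj 𝒜 e
  have hsum (σ : A →+* ℂ) : σ (GradedRing.proj 𝒜 0 e) =
      ((∑ i ∈ insert 0 S, ‖σ (GradedRing.proj 𝒜 i e)‖ ^ 2 : ℝ) : ℂ) := by
    have h := proj_zero_mul 𝒜 (hS (insert 0 S) (Finset.subset_insert 0 S)) e
    rw [he.eq] at h
    conv_lhs => rw [h, map_sum]
    rw [Complex.ofReal_sum]
    refine Finset.sum_congr rfl fun i _ => ?_
    rw [map_mul, hconj, Complex.mul_conj, Complex.normSq_eq_norm_sq]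
  have hle (σ : A →+* ℂ) : ‖σ (GradedRing.proj 𝒜 0 e)‖ =
      ∑ i ∈ insert 0 S, ‖σ (GradedRing.proj 𝒜 i e)‖ ^ 2 := by
    rw [hsum, Complex.norm_real, Real.norm_of_nonneg (Finset.sum_nonneg fun i _ => sq_nonneg _)]
  have h01 := eq_zero_or_one_of_forall_mem_unitInterval (a := GradedRing.proj 𝒜 0 e) (fun σ => by
    refine ⟨‖σ (GradedRing.proj 𝒜 0 e)‖, norm_nonneg _, ?_, ?_⟩
    · have h1 : ‖σ (GradedRing.proj 𝒜 0 e)‖ ^ 2 ≤ ‖σ (GradedRing.proj 𝒜 0 e)‖ := by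
        conv_rhs => rw [hle]
        exact Finset.single_le_sum (f := fun i => ‖σ (GradedRing.proj 𝒜 i e)‖ ^ 2)
          (fun i _ => sq_nonneg _) (Finset.mem_insert_self 0 S)
      nlinarith [norm_nonneg (σ (GradedRing.proj 𝒜 0 e))]
    · rw [hle]; exact hsum σ)
  have hoff : ∀ j ≠ 0, IsNilpotent (GradedRing.proj 𝒜 j e) := by
    intro j hj
    refine isNilpotent_of_forall_ringHom_eq_zero fun σ => ?_
    by_cases hjS : j ∈ S
    · have h1 := hle σ
      rw [← Finset.add_sum_erase _ _ (Finset.mem_insert_self 0 S)] at h1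
      have h2 : ‖σ (GradedRing.proj 𝒜 0 e)‖ = ‖σ (GradedRing.proj 𝒜 0 e)‖ ^ 2 := by
        rcases h01 σ with h | h <;> rw [h] <;> simp
      have h3 : ‖σ (GradedRing.proj 𝒜 j e)‖ ^ 2 ≤
          ∑ i ∈ (insert 0 S).erase 0, ‖σ (GradedRing.proj 𝒜 i e)‖ ^ 2 :=
        Finset.single_le_sum (f := fun i => ‖σ (GradedRing.proj 𝒜 i e)‖ ^ 2)
          (fun i _ => sq_nonneg _) (Finset.mem_erase.mpr ⟨hj, Finset.mem_insert_of_mem hjS⟩)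
      have h4 : ‖σ (GradedRing.proj 𝒜 j e)‖ ^ 2 ≤ 0 := by linarith
      simpa using le_antisymm h4 (sq_nonneg _)
    · rw [hS0 j hjS, map_zero]
  set e₀ := GradedRing.proj 𝒜 0 e with he₀
  have he₀_mem : e₀ ∈ 𝒜 0 := proj_mem 𝒜 0 e
  have hunit : IsUnit (1 - 2 * e₀) := by
    have hnil : IsNilpotent (4 * (e₀ ^ 2 - e₀)) :=
      isNilpotent_of_forall_ringHom_eq_zero fun σ => by
        rcases h01 σ with h | h <;> simp [h]
    have h := hnil.isUnit_one_add
    have hsq : 1 + 4 * (e₀ ^ 2 - e₀) = (1 - 2 * e₀) * (1 - 2 * e₀) := by ring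
    rw [hsq] at h
    exact isUnit_of_mul_isUnit_left h
  refine mem_of_forall_nsmul_proj_mem 𝒜 hoff one_ne_zero fun j hj => ?_
  have hν := sub_proj_mem_offDiagonal 𝒜 e 0
  have hsq := proj_mem_offDiagonal_mul 𝒜 (Ideal.mul_mem_mul hν hν) j
  -- In degree `j ≠ 0` the right side is `(1 - 2 * e₀) * e_j`, a unit times `e_j`.
  have hexp : (e - e₀) * (e - e₀) = e + e₀ * e₀ - 2 • (e₀ * e) := by
    linear_combination he.eq
  have hmul : GradedRing.proj 𝒜 j (e₀ * e) = e₀ * GradedRing.proj 𝒜 j e := by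
    have := proj_add_mul 𝒜 he₀_mem j e
    rwa [zero_add] at this
  have hmul₀ : GradedRing.proj 𝒜 j (e₀ * e₀) = 0 := by
    refine proj_of_mem_ne 𝒜 (i := 0) ?_ hj.symm
    have := SetLike.mul_mem_graded he₀_mem he₀_mem
    rwa [add_zero] at this
  rw [← he₀, hexp, map_sub, map_add, map_nsmul, hmul, hmul₀] at hsq
  rw [one_smul, ← Ideal.unit_mul_mem_iff_mem _ hunit]
  convert hsq using 1
  simp only [nsmul_eq_mul]
  push_cast
  ring

/-- In a graded order without nontrivial idempotents, roots of unity are homogeneous. -/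
theorem exists_mem_of_pow_eq_one [Nontrivial A]
    (hA : ∀ e : A, IsIdempotentElem e → e = 0 ∨ e = 1) {x : A} {n : ℕ} (hn : n ≠ 0)
    (hx : x ^ n = 1) : ∃ i, x ∈ 𝒜 i := by
  have hxy : x * x ^ (n - 1) = 1 := by rw [mul_pow_sub_one hn, hx]
  set y := x ^ (n - 1) with hy
  have hconj := ringHom_proj_neg_eq_conj 𝒜 (x := x) (y := y) (fun σ => by
    have h1 : σ x * σ y = 1 := by rw [← map_mul, hxy, map_one]
    have h2 : ‖σ x‖ = 1 := Complex.norm_eq_one_of_pow_eq_one (by rw [← map_pow, hx, map_one]) hn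
    rw [← Complex.inv_eq_conj h2]
    exact eq_inv_of_mul_eq_one_right h1)
  obtain ⟨S, hS0, hS⟩ := exists_finset_proj 𝒜 x
  let a (i : ι) : A := GradedRing.proj 𝒜 i x * GradedRing.proj 𝒜 (-i) y
  have ha (σ : A →+* ℂ) (i : ι) :
      σ (a i) = ((‖σ (GradedRing.proj 𝒜 i x)‖ ^ 2 : ℝ) : ℂ) := by
    rw [map_mul, hconj, Complex.mul_conj, Complex.normSq_eq_norm_sq]
  have hsum : ∑ i ∈ S, a i = 1 := by
    rw [← proj_zero_mul 𝒜 (hS S subset_rfl), hxy]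
    exact proj_of_mem 𝒜 SetLike.GradedOne.one_mem
  have hnorm (σ : A →+* ℂ) : ∑ i ∈ S, ‖σ (GradedRing.proj 𝒜 i x)‖ ^ 2 = 1 := by
    have h := congrArg σ hsum
    rw [map_sum, map_one, Finset.sum_congr rfl fun i _ => ha σ i] at h
    exact_mod_cast h
  have hle (σ : A →+* ℂ) (i : ι) (hi : i ∈ S) : ‖σ (GradedRing.proj 𝒜 i x)‖ ^ 2 ≤ 1 := by
    rw [← hnorm σ]
    exact Finset.single_le_sum (f := fun i => ‖σ (GradedRing.proj 𝒜 i x)‖ ^ 2)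
      (fun i _ => sq_nonneg _) hi
  have hidem : ∀ i ∈ S, IsNilpotent (a i * a i - a i) := fun i hi =>
    isNilpotent_of_forall_ringHom_eq_zero fun σ => by
      rcases eq_zero_or_one_of_forall_mem_unitInterval
        (fun σ => ⟨_, sq_nonneg _, hle σ i hi, ha σ i⟩) σ with h | h <;> simp [h]
  -- The `a i` sum to `1` and each is nilpotent or unipotent; they cannot all be nilpotent.
  obtain ⟨i, hi, hai⟩ : ∃ i ∈ S, IsNilpotent (a i - 1) := by
    by_contra! hcon
    have h0 : ∀ i ∈ S, a i ∈ nilradical A := fun i hi =>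
      (isNilpotent_or_isNilpotent_sub_one hA (hidem i hi)).resolve_right (hcon i hi)
    have h1 : IsNilpotent (1 : A) := by
      rw [← hsum]
      exact sum_mem h0
    exact not_isNilpotent_one h1
  have hone (σ : A →+* ℂ) : ‖σ (GradedRing.proj 𝒜 i x)‖ ^ 2 = 1 := by
    have h := (hai.map σ).eq_zero
    rw [map_sub, map_one, sub_eq_zero, ha] at h
    exact_mod_cast h
  have hoff : ∀ j ≠ i, IsNilpotent (GradedRing.proj 𝒜 j x) := by
    intro j hj
    refine isNilpotent_of_forall_ringHom_eq_zero fun σ => ?_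
    by_cases hjS : j ∈ S
    · have h1 := hnorm σ
      rw [← Finset.add_sum_erase _ _ hi, hone] at h1
      have h2 : ‖σ (GradedRing.proj 𝒜 j x)‖ ^ 2 ≤
          ∑ i ∈ S.erase i, ‖σ (GradedRing.proj 𝒜 i x)‖ ^ 2 :=
        Finset.single_le_sum (f := fun i => ‖σ (GradedRing.proj 𝒜 i x)‖ ^ 2)
          (fun i _ => sq_nonneg _) (Finset.mem_erase.mpr ⟨hj, hjS⟩)
      have h3 : ‖σ (GradedRing.proj 𝒜 j x)‖ ^ 2 ≤ 0 := by linarith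
      simpa using le_antisymm h3 (sq_nonneg _)
    · rw [hS0 j hjS, map_zero]
  set u := GradedRing.proj 𝒜 i x with hu
  have hu_mem : u ∈ 𝒜 i := proj_mem 𝒜 i x
  have hu_unit : IsUnit u := by
    have h := hai.isUnit_one_add
    rw [add_sub_cancel] at h
    exact isUnit_of_mul_isUnit_left h
  have hν := sub_proj_mem_offDiagonal 𝒜 x i
  rw [← hu] at hν
  have hν_nil : IsNilpotent (x - u) := by
    have hle : offDiagonal 𝒜 x i ≤ nilradical A :=
      Ideal.span_le.mpr (by rintro _ ⟨j, hj, rfl⟩; exact hoff j hj)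
    exact hle hν
  have hpow_mem : u ^ n ∈ 𝒜 (n • i) := SetLike.pow_mem_graded n hu_mem
  -- Otherwise the degree-zero component of the nilpotent `1 - u ^ n` would be `1`.
  have hdeg : n • i = 0 := by
    by_contra hne
    have h1 : IsNilpotent (x ^ n - u ^ n) := by
      obtain ⟨k, hk⟩ := sub_dvd_pow_sub_pow x u n
      rw [hk]
      exact (Commute.all _ _).isNilpotent_mul_right hν_nil
    have h2 := isNilpotent_proj 𝒜 h1 0
    rw [hx, map_sub, proj_of_mem_ne 𝒜 hpow_mem hne, sub_zero,
      proj_of_mem 𝒜 SetLike.GradedOne.one_mem] at h2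
    exact not_isNilpotent_one h2
  refine ⟨i, mem_of_forall_nsmul_proj_mem 𝒜 hoff hn fun j hj => ?_⟩
  -- Taylor expansion of `x ^ n = 1` at `u`; its component in degree `(n - 1) • i + j`, nonzero as
  -- `j ≠ i`, puts `n u ^ (n - 1) x_j` in `J²`.
  obtain ⟨k, hk⟩ := Polynomial.powAddExpansion u (x - u) n
  have hpow1 : u ^ (n - 1) ∈ 𝒜 ((n - 1) • i) := SetLike.pow_mem_graded _ hu_mem
  have hsucc : (n - 1) • i + i = 0 := by rw [← succ_nsmul, Nat.sub_add_cancel (by omega), hdeg]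
  have hd : 0 ≠ (n - 1) • i + j := by
    intro h
    rw [← hsucc] at h
    exact hj (add_left_cancel h).symm
  have hsq := proj_mem_offDiagonal_mul 𝒜
    (Ideal.mul_mem_left _ (-k) (Ideal.mul_mem_mul hν hν)) ((n - 1) • i + j)
  have hexp : -k * ((x - u) * (x - u)) = n • (u ^ (n - 1) * (x - u)) + u ^ n - 1 := by
    rw [add_sub_cancel, hx] at hk
    rw [nsmul_eq_mul]
    linear_combination hk
  have hpow0 : u ^ n ∈ 𝒜 0 := hdeg ▸ hpow_mem
  rw [hexp, map_sub, map_add, map_nsmul, proj_add_mul 𝒜 hpow1, proj_of_mem_ne 𝒜 hpow0 hd,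
    proj_of_mem_ne 𝒜 SetLike.GradedOne.one_mem hd, map_sub, proj_of_mem_ne 𝒜 hu_mem hj.symm,
    sub_zero, sub_zero, add_zero, ← mul_smul_comm] at hsq
  exact (Ideal.unit_mul_mem_iff_mem _ (hu_unit.pow (n - 1))).mp hsq

end Graded

/-! ### Connectedness and the main theorem -/

theorem isConnectedRing_iff {R : Type*} [CommRing R] :
    IsConnectedRing R ↔ Nontrivial R ∧ ∀ e : R, IsIdempotentElem e → e = 0 ∨ e = 1 := by
  have h0 : (0 : R) ∈ idempotents R := by simp [idempotents]
  have h1 : (1 : R) ∈ idempotents R := by simp [idempotents]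
  constructor
  · intro h
    obtain ⟨a, b, hab, hs⟩ := Set.encard_eq_two.mp h
    have hnt : Nontrivial R := ⟨a, b, hab⟩
    refine ⟨hnt, fun e he => ?_⟩
    have he' : e ∈ idempotents R := by exact (sq e).trans he
    have h01 : (0 : R) ≠ 1 := zero_ne_one
    rw [hs] at h0 h1 he'
    simp only [Set.mem_insert_iff, Set.mem_singleton_iff] at h0 h1 he'
    grind
  · rintro ⟨hnt, h⟩
    refine Set.encard_eq_two.mpr ⟨0, 1, zero_ne_one, ?_⟩
    ext e
    constructor
    · intro he
      exact h e (by rw [IsIdempotentElem, ← sq]; exact he)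
    · rintro (rfl | rfl)
      exacts [h0, h1]

end GradedOrder

open GradedOrder in
theorem theorem1p3 {Γ A : Type*} [CommGroup Γ] [DecidableEq Γ] [CommRing A]
    (hA : GradedOrder.IsOrder A) (B : Γ → AddSubgroup A) (hB : GradedOrder.IsGrading B) :
    GradedOrder.IsHomogeneousSubgroup B (Submodule.toAddSubgroup (nilradical A)) ∧
    (GradedOrder.idempotents A = Subtype.val '' GradedOrder.idempotents hB.oneSubring ∧
      (GradedOrder.IsConnectedRing A ↔ GradedOrder.IsConnectedRing hB.oneSubring)) ∧
    (GradedOrder.IsConnectedRing hB.oneSubring →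
      ∀ x ∈ GradedOrder.rootsOfOne A, GradedOrder.IsHomogeneousElement B x) := by
  have := hA.module_finite
  have := hA.isAddTorsionFree
  let 𝒜 : Additive Γ → AddSubgroup A := fun i => B i.toMul
  have hint : DirectSum.IsInternal 𝒜 := hB.isInternal
  let _ : DirectSum.Decomposition 𝒜 := hint.chooseDecomposition
  have : SetLike.GradedMonoid 𝒜 :=
    { one_mem := hB.one_mem
      mul_mem := fun i j x y hx hy => hB.mul_mem _ _ x y hx hy }
  let _ : GradedRing 𝒜 := { }
  have hidem : ∀ e : A, IsIdempotentElem e → e ∈ B 1 := fun e he =>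
    mem_zero_of_isIdempotentElem 𝒜 he
  have hconn : IsConnectedRing A ↔ IsConnectedRing hB.oneSubring := by
    rw [isConnectedRing_iff, isConnectedRing_iff]
    constructor
    · rintro ⟨hnt, h⟩
      refine ⟨inferInstance, fun e he => ?_⟩
      rcases h e (congrArg Subtype.val he) with h' | h'
      · exact Or.inl (Subtype.ext h')
      · exact Or.inr (Subtype.ext h')
    · rintro ⟨hnt, h⟩
      refine ⟨hB.oneSubring.subtype_injective.nontrivial, fun e he => ?_⟩
      have hmem : e ∈ hB.oneSubring := hidem e he
      rcases h ⟨e, hmem⟩ (Subtype.ext he.eq) with h' | h'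
      · exact Or.inl (congrArg Subtype.val h')
      · exact Or.inr (congrArg Subtype.val h')
  refine ⟨?_, ⟨?_, hconn⟩, ?_⟩
  · intro x
    constructor
    · intro hx γ
      have h := isNilpotent_proj 𝒜 (x := DirectSum.coeAddMonoidHom B x) hx (Additive.ofMul γ)
      have hdec : DirectSum.decompose 𝒜 (DirectSum.coeAddMonoidHom B x) = x :=
        DirectSum.Decomposition.right_inv (ℳ := 𝒜) x
      rw [GradedRing.proj_apply, hdec] at h
      exact h
    · intro h
      classical
      rw [DirectSum.coeAddMonoidHom_eq_dfinsuppSum, DFinsupp.sum]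
      exact sum_mem fun γ _ => h γ
  · ext e
    constructor
    · intro he
      have he' : e ∈ hB.oneSubring := hidem e (by rw [IsIdempotentElem, ← sq]; exact he)
      exact ⟨⟨e, he'⟩, Subtype.ext he, rfl⟩
    · rintro ⟨e, he, rfl⟩
      exact congrArg Subtype.val he
  · rintro h x ⟨n, hn, hx⟩
    obtain ⟨hnt, hA'⟩ := isConnectedRing_iff.mp (hconn.mpr h)
    obtain ⟨i, hi⟩ := exists_mem_of_pow_eq_one 𝒜 hA' hn.ne' hx
    exact ⟨i.toMul, hi⟩
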